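/- Let $N_0\subseteq\mathbb R$ be an open interval containing $0$, let $f,g\in C^1(N_0)$, and put $F(x)=\int_0^x f(t)\,dt$. Consider the equation $$(E)\qquad \ddot x+f(x)\dot x^2+g(x)=0,$$ i.e. the planar system $\dot x=y,\ \dot y=-g(x)-f(x)y^2$. The origin is a *center* of (E) if it is a stationary point and there are arbitrarily small neighbourhoods $U$ of it such that every orbit starting in $U\setminus\{(0,0)\}$ is a non-constant periodic orbit contained in $U$. A center is *isochronous* if the minimal period of these orbits is the same for all of them in some punctured neighbourhood of the origin. (i) If $x\,g(x)>0$ for all $x\in N_0\setminus\{0\}$, then $0$ is a center of (E). If $g$ is analytic on $N_0$, then $0$ is a center of (E) if and only if $x\,g(x)>0$ for all $x\neq 0$ in some neighbourhood of $0$. (ii) Suppose that $N_0$ is symmetric about $0$ and that, for some constant $K>0$ and all $x\in N_0$, $$e^{F(x)}+e^{F(-x)}=2\qquad\text{and}\qquad g(x)=K\,\frac{x}{e^{2F(x)}}.$$ Then $0$ is an isochronous center of (E). (iii) If, in addition to the hypotheses of (ii), $g$ is odd, then $0$ is an isochronous center of (E) if and only if $f(x)=0$ and $g(x)=Kx$ for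 all $x\in N_0$. Moreover, without the hypothesis $e^{F(x)}+e^{F(-x)}=2$: if $N_0$ is symmetric about $0$, $g(x)=Kxe^{-2F(x)}$ on $N_0$ with $K>0$, and $g$ is odd, then $0$ is an isochronous center of (E) if and only if $f(x)=0$ and $g(x)=Kx$ for all $x$ in some neighbourhood of $0$. -/

import Mathlib

open Topology

noncomputable section

/-- `γ` is a complete solution of the autonomous planar system `q' = V q` which is periodic with
minimal period `T > 0` (in particular it is not constant): a closed orbit of period `T`. -/
def IsCycle (V : ℝ × ℝ → ℝ × ℝ) (γ : ℝ → ℝ × ℝ) (T : ℝ) : Prop :=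
  (∀ t, HasDerivAt γ (V (γ t)) t) ∧ 0 < T ∧ Function.Periodic γ T ∧
    ∀ S, 0 < S → Function.Periodic γ S → T ≤ S

/-- The stationary point `p` is a center of `q' = V q`: there are neighbourhoods `U` of `p`
in which all orbits other than `p` itself are closed. The orbits have to remain in `U`, and `U`
can be taken as small as one likes, so that the notion only depends on `V` near `p`. -/
def IsCenter (V : ℝ × ℝ → ℝ × ℝ) (p : ℝ × ℝ) : Prop :=
  V p = 0 ∧ ∀ W ∈ 𝓝 p, ∃ U ∈ 𝓝 p, U ⊆ W ∧
    ∀ q ∈ U, q ≠ p → ∃ γ T, γ 0 = q ∧ IsCycle V γ T ∧ ∀ t, γ t ∈ U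

/-- The center `p` is isochronous: the period function (minimal period of the closed orbit through
a point) is constant in a punctured neighbourhood of `p`. -/
def IsIsochronousCenter (V : ℝ × ℝ → ℝ × ℝ) (p : ℝ × ℝ) : Prop :=
  IsCenter V p ∧ ∃ T, ∃ U ∈ 𝓝 p, ∀ q ∈ U, q ≠ p →
    ∀ γ S, γ 0 = q → IsCycle V γ S → S = T

/-- The planar system `x' = y`, `y' = -g(x) - f(x) y²` equivalent to `x'' + f(x) x'² + g(x) = 0`. -/
def lienardField (f g : ℝ → ℝ) (q : ℝ × ℝ) : ℝ × ℝ :=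
  (q.2, -g q.1 - f q.1 * q.2 ^ 2)

/-- `F(x) = ∫₀ˣ f(t) dt`. -/
def primitiveF (f : ℝ → ℝ) (x : ℝ) : ℝ := ∫ t in (0 : ℝ)..x, f t

end

/-! The function `H = e^{2F} y²/2 + ∫₀ˣ e^{2F} g` is a first integral. Its derivative along rays
from the origin is positive near `0` when `x g(x) > 0`, so its small level curves are graphs `r(θ)`
in polar coordinates, hence closed orbits (`isCenter_of_radially_increasing`). Conversely, an
analytic `g` either vanishes near `0`, and then points of the `x`-axis are stationary, or has a
fixed sign on each side; the extremal points of a cycle then decide the signs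
(`exists_extremal_points`).

If `g = K x e^{-2F}`, then `H = (e^{2F} y² + K x²)/2`, and its levels are parametrized by `x = A sin
θ`, `e^F y = A √K cos θ`. Since `x' = y`, the period is `(1/√K) ∫ e^{F(A sin θ)} dθ` over a full
turn (`exists_isCycle_of_amplitude`). Pairing `θ` with `θ + π` shows that the functional equation
makes it `2π/√K`. Conversely, a constant period means that `e^{F(A sin θ)} - 1` has mean zero for
every small `A`, and injectivity of the Abel transform (`add_neg_eq_zero_of_integral_sin_eq_zero`)
returns the functional equation near `0`. For odd `g` the primitive `F` is even, so the functional
equation forces `e^F = 1`. -/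

theorem hasStrictDerivAt_intervalIntegral_of_continuousOn {N : Set ℝ} (ho : IsOpen N)
    (hc : N.OrdConnected) (h0 : (0 : ℝ) ∈ N) {f : ℝ → ℝ} (hf : ContinuousOn f N) {x : ℝ}
    (hx : x ∈ N) : HasStrictDerivAt (fun x => ∫ t in (0 : ℝ)..x, f t) (f x) x :=
  intervalIntegral.integral_hasStrictDerivAt_right
    ((hf.mono (hc.uIcc_subset h0 hx)).intervalIntegrable)
    (hf.stronglyMeasurableAtFilter ho x hx) (hf.continuousAt (ho.mem_nhds hx))

theorem hasStrictDerivAt_primitiveF {N : Set ℝ} (ho : IsOpen N) (hc : N.OrdConnected)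
    (h0 : (0 : ℝ) ∈ N) {f : ℝ → ℝ} (hf : ContinuousOn f N) {x : ℝ} (hx : x ∈ N) :
    HasStrictDerivAt (primitiveF f) (f x) x :=
  hasStrictDerivAt_intervalIntegral_of_continuousOn ho hc h0 hf hx

theorem continuousOn_primitiveF {N : Set ℝ} (ho : IsOpen N) (hc : N.OrdConnected)
    (h0 : (0 : ℝ) ∈ N) {f : ℝ → ℝ} (hf : ContinuousOn f N) : ContinuousOn (primitiveF f) N :=
  fun _ hx => (hasStrictDerivAt_primitiveF ho hc h0 hf hx).hasDerivAt.continuousAt.continuousWithinAt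

@[simp] theorem primitiveF_zero (f : ℝ → ℝ) : primitiveF f 0 = 0 := by
  simp [primitiveF]

/-! ### Time changes and uniqueness of solutions -/

/-- A closed curve whose velocity is a positive multiple of `V` is, up to a change of time, a
cycle of `V`, and its period is the integral of the multiplier. -/
theorem exists_isCycle_of_reparametrization {V : ℝ × ℝ → ℝ × ℝ} {c : ℝ → ℝ × ℝ} {ω : ℝ → ℝ}
    (hω : Continuous ω) (hpos : ∀ θ, 0 < ω θ) (hωp : Function.Periodic ω (2 * Real.pi))
    (hc : ∀ θ, HasDerivAt c (ω θ • V (c θ)) θ) (hcp : Function.Periodic c (2 * Real.pi))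
    (hinj : ∀ a b, c a = c b → Real.cos (b - a) = 1) (θ₀ : ℝ) :
    ∃ γ, γ 0 = c θ₀ ∧ IsCycle V γ (∫ θ in (0 : ℝ)..(2 * Real.pi), ω θ) ∧
      ∀ t, ∃ θ, γ t = c θ := by
  set T := ∫ θ in (0 : ℝ)..(2 * Real.pi), ω θ with hT
  have hii : ∀ a b, IntervalIntegrable ω MeasureTheory.volume a b := fun a b =>
    hω.intervalIntegrable a b
  have hTpos : 0 < T := intervalIntegral.intervalIntegral_pos_of_pos (hii _ _) hpos
    (by positivity)
  set τ : ℝ → ℝ := fun θ => ∫ s in θ₀..θ, ω s with hτ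
  have hτd : ∀ θ, HasDerivAt τ (ω θ) θ := fun θ => hω.integral_hasStrictDerivAt θ₀ θ |>.hasDerivAt
  have hτm : StrictMono τ := strictMono_of_deriv_pos fun θ => by rw [(hτd θ).deriv]; exact hpos θ
  have hτp : ∀ θ, τ (θ + 2 * Real.pi) = τ θ + T := by
    intro θ
    have h1 := intervalIntegral.integral_add_adjacent_intervals (hii θ₀ θ)
      (hii θ (θ + 2 * Real.pi))
    have h2 := hωp.intervalIntegral_add_eq θ 0
    rw [zero_add] at h2
    simp only [hτ, hT, ← h1, h2]
  -- These values are unbounded in both directions, which makes `τ` surjective.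
  have hτn : ∀ n : ℕ, τ (θ₀ + n * (2 * Real.pi)) = n * T ∧ τ (θ₀ - n * (2 * Real.pi)) = -(n * T) := by
    intro n
    induction n with
    | zero => simp [hτ]
    | succ k ih =>
      constructor
      · have := hτp (θ₀ + k * (2 * Real.pi))
        rw [ih.1] at this
        push_cast
        rw [show θ₀ + (k + 1) * (2 * Real.pi) = θ₀ + k * (2 * Real.pi) + 2 * Real.pi by ring, this]
        ring
      · have := hτp (θ₀ - (k + 1) * (2 * Real.pi))
        rw [show θ₀ - (k + 1) * (2 * Real.pi) + 2 * Real.pi = θ₀ - k * (2 * Real.pi) by ring,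
          ih.2] at this
        push_cast
        linarith
  have hτc : Continuous τ := continuous_iff_continuousAt.2 fun θ => (hτd θ).continuousAt
  have hτs : Function.Surjective τ := by
    intro t
    obtain ⟨n, hn⟩ := exists_nat_gt (|t| / T)
    rw [div_lt_iff₀ hTpos] at hn
    have := abs_lt.1 hn
    refine mem_range_of_exists_le_of_exists_ge hτc ⟨θ₀ - n * (2 * Real.pi), ?_⟩
      ⟨θ₀ + n * (2 * Real.pi), ?_⟩
    · rw [(hτn n).2]; exact this.1.le
    · rw [(hτn n).1]; exact this.2.le
  set e := hτm.orderIsoOfSurjective τ hτs with he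
  have hinv : ∀ t, τ (e.symm t) = t := fun t => e.apply_symm_apply t
  have hsd : ∀ t, HasDerivAt e.symm (ω (e.symm t))⁻¹ t := fun t =>
    HasDerivAt.of_local_left_inverse (e.symm.continuous.continuousAt) (hτd _) (hpos _).ne'
      (Filter.Eventually.of_forall hinv)
  have hshift : ∀ t, e.symm (t + T) = e.symm t + 2 * Real.pi := by
    intro t
    apply hτm.injective
    rw [hinv, hτp, hinv]
  refine ⟨fun t => c (e.symm t), ?_, ⟨?_, hTpos, ?_, ?_⟩, fun t => ⟨_, rfl⟩⟩
  · have : e.symm 0 = θ₀ := hτm.injective (by rw [hinv]; simp [hτ])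
    simp [this]
  · intro t
    have := (hc (e.symm t)).scomp t (hsd t)
    rwa [smul_smul, inv_mul_cancel₀ (hpos _).ne', one_smul] at this
  · intro t
    simp only [hshift, hcp _]
  -- A period below `T` would advance the angle by an amount strictly between `0` and `2π`, whose
  -- cosine cannot be `1`.
  · intro S hS hper
    by_contra! hlt
    have h1 := hinj _ _ (hper 0).symm
    have h2 : e.symm 0 < e.symm (0 + S) := e.symm.strictMono (by linarith)
    have h3 : e.symm (0 + S) < e.symm 0 + 2 * Real.pi := by
      rw [← hshift]; exact e.symm.strictMono (by linarith)
    rw [Real.cos_eq_one_iff_of_lt_of_lt (by linarith [Real.pi_pos]) (by linarith)] at h1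
    linarith

/-- Two global solutions which agree at one time agree for all times, provided that the field is
`C¹` along one of them. -/
theorem solution_unique_of_contDiffAt {V : ℝ × ℝ → ℝ × ℝ} {γ δ : ℝ → ℝ × ℝ}
    (hV : ∀ t, ContDiffAt ℝ 1 V (γ t)) (hγ : ∀ t, HasDerivAt γ (V (γ t)) t)
    (hδ : ∀ t, HasDerivAt δ (V (δ t)) t) (h0 : γ 0 = δ 0) : γ = δ := by
  have cγ : Continuous γ := continuous_iff_continuousAt.2 fun t => (hγ t).continuousAt
  have cδ : Continuous δ := continuous_iff_continuousAt.2 fun t => (hδ t).continuousAt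
  -- Closed by continuity, open by local Lipschitz uniqueness; the line is connected.
  have hcl : IsClopen {t | γ t = δ t} := by
    refine ⟨isClosed_eq cγ cδ, isOpen_iff_mem_nhds.2 fun t ht => ?_⟩
    obtain ⟨K, s, hs, hK⟩ := (hV t).exists_lipschitzOnWith
    have ht' : γ t = δ t := ht
    exact ODE_solution_unique_of_eventually (v := fun _ => V) (s := fun _ => s)
      (Filter.Eventually.of_forall fun _ => hK)
      ((cγ.continuousAt.eventually hs).mono fun u hu => ⟨hγ u, hu⟩)
      ((cδ.continuousAt.eventually (by rw [← ht']; exact hs)).mono fun u hu => ⟨hδ u, hu⟩) ht'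
  have := hcl.eq_univ ⟨0, h0⟩
  funext t
  have ht : t ∈ {t | γ t = δ t} := this ▸ Set.mem_univ t
  exact ht

theorem contDiffAt_lienardField {N : Set ℝ} (ho : IsOpen N) {f g : ℝ → ℝ}
    (hf : ContDiffOn ℝ 1 f N) (hg : ContDiffOn ℝ 1 g N) {q : ℝ × ℝ} (hq : q.1 ∈ N) :
    ContDiffAt ℝ 1 (lienardField f g) q := by
  have h1 : ContDiffAt ℝ 1 (fun q : ℝ × ℝ => f q.1) q :=
    (hf.contDiffAt (ho.mem_nhds hq)).comp q contDiffAt_fst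
  have h2 : ContDiffAt ℝ 1 (fun q : ℝ × ℝ => g q.1) q :=
    (hg.contDiffAt (ho.mem_nhds hq)).comp q contDiffAt_fst
  exact contDiffAt_snd.prodMk (h2.neg.sub (h1.mul (contDiffAt_snd.pow 2)))

theorem IsCycle.period_unique {V : ℝ × ℝ → ℝ × ℝ} {γ : ℝ → ℝ × ℝ} {S T : ℝ}
    (hS : IsCycle V γ S) (hT : IsCycle V γ T) : S = T :=
  le_antisymm (hS.2.2.2 T hT.2.1 hT.2.2.1) (hT.2.2.2 S hS.2.1 hS.2.2.1)

/-! ### Centers from first integrals increasing along rays -/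

/-- Continuity of `r` is not assumed: local uniqueness of the solution forces `r` to coincide with
the implicit function, which is differentiable. -/
theorem hasDerivAt_of_implicit {h : ℝ × ℝ → ℝ} {a b θ ρ : ℝ}
    (hh : HasStrictFDerivAt h
      (a • ContinuousLinearMap.fst ℝ ℝ ℝ + b • ContinuousLinearMap.snd ℝ ℝ ℝ) (θ, ρ))
    (hb : b ≠ 0) {r : ℝ → ℝ} (hr : r θ = ρ)
    (huniq : ∀ᶠ p in 𝓝 (θ, ρ), h p = h (θ, ρ) → r p.1 = p.2) :
    HasDerivAt r (-(a / b)) θ := by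
  have hinv : ((a • ContinuousLinearMap.fst ℝ ℝ ℝ + b • ContinuousLinearMap.snd ℝ ℝ ℝ) ∘SL
      ContinuousLinearMap.inr ℝ ℝ ℝ).IsInvertible := by
    refine ⟨ContinuousLinearEquiv.unitsEquivAut ℝ (Units.mk0 b hb), ?_⟩
    ext
    simp
  set ψ := hh.implicitFunctionOfProdDomain hinv with hψ
  have hψd : DifferentiableAt ℝ ψ θ :=
    (hh.hasStrictFDerivAt_implicitFunctionOfProdDomain hinv).hasFDerivAt.differentiableAt
  have hψt : Filter.Tendsto ψ (𝓝 θ) (𝓝 ρ) := hh.tendsto_implicitFunctionOfProdDomain hinv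
  have hψe : ∀ᶠ x in 𝓝 θ, h (x, ψ x) = h (θ, ρ) :=
    hh.eventually_apply_implicitFunctionOfProdDomain hinv
  have hrψ : r =ᶠ[𝓝 θ] ψ := by
    have ht : Filter.Tendsto (fun x => (x, ψ x)) (𝓝 θ) (𝓝 (θ, ρ)) :=
      Filter.tendsto_id.prodMk_nhds hψt
    filter_upwards [ht.eventually huniq, hψe] with x hx hx'
    exact hx hx'
  have hψθ : ψ θ = ρ := by rw [← hrψ.eq_of_nhds, hr]
  have hd := hψd.hasDerivAt
  have hcomp : HasDerivAt (fun x => h (x, ψ x)) (a + b * deriv ψ θ) θ := by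
    have h1 : HasFDerivAt h (a • ContinuousLinearMap.fst ℝ ℝ ℝ
        + b • ContinuousLinearMap.snd ℝ ℝ ℝ) (θ, ψ θ) := by
      rw [hψθ]; exact hh.hasFDerivAt
    exact (h1.comp_hasDerivAt θ ((hasDerivAt_id θ).prodMk hd)).congr_deriv (by simp)
  have h0 : a + b * deriv ψ θ = 0 :=
    hcomp.unique ((hasDerivAt_const θ (h (θ, ρ))).congr_of_eventuallyEq hψe)
  have : deriv ψ θ = -(a / b) := by field_simp; linarith
  rw [← this]
  exact hd.congr_of_eventuallyEq hrψ

theorem exists_polar (q : ℝ × ℝ) :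
    ∃ θ, q = (√(q.1 ^ 2 + q.2 ^ 2) * Real.sin θ, √(q.1 ^ 2 + q.2 ^ 2) * Real.cos θ) := by
  -- The coordinates are swapped so that the angle grows clockwise, in the direction of the flow `x'
  -- = y`.
  refine ⟨Complex.arg ⟨q.2, q.1⟩, ?_⟩
  have hn : √(q.1 ^ 2 + q.2 ^ 2) = ‖(⟨q.2, q.1⟩ : ℂ)‖ := by
    rw [Complex.norm_def, Complex.normSq_mk]; congr 1; ring
  rw [hn, Complex.norm_mul_cos_arg, Complex.norm_mul_sin_arg]

/-- A field tangent to the level curves of a function which increases along the rays from the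
origin has a center there. -/
theorem isCenter_of_radially_increasing {V : ℝ × ℝ → ℝ × ℝ} {H P Q μ : ℝ × ℝ → ℝ}
    {S : Set (ℝ × ℝ)} (hS : S ∈ 𝓝 (0, 0)) (hV0 : V (0, 0) = 0) (hH0 : H (0, 0) = 0)
    (hH : ∀ q ∈ S, HasStrictFDerivAt H
      (P q • ContinuousLinearMap.fst ℝ ℝ ℝ + Q q • ContinuousLinearMap.snd ℝ ℝ ℝ) q)
    (hP : ContinuousOn P S) (hQ : ContinuousOn Q S) (hμ : ContinuousOn μ S)
    (hμpos : ∀ q ∈ S, 0 < μ q) (hV : ∀ q ∈ S, V q = μ q • (Q q, -P q))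
    (hrad : ∀ q ∈ S, q ≠ 0 → 0 < q.1 * P q + q.2 * Q q) : IsCenter V (0, 0) := by
  refine ⟨hV0, fun W hW => ?_⟩
  obtain ⟨ε, hε, hball⟩ := Metric.mem_nhds_iff.1 (Filter.inter_mem hS hW)
  -- The product carries the sup norm; the closed Euclidean disk of radius `ε / 2` lies in its open
  -- `ε`-ball.
  set R := ε / 2 with hR
  have hRpos : 0 < R := by positivity
  have hdisk : ∀ q : ℝ × ℝ, q.1 ^ 2 + q.2 ^ 2 ≤ R ^ 2 → q ∈ S ∩ W := by
    intro q hq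
    apply hball
    rw [mem_ball_iff_norm, show q - (0, 0) = q by simp, Prod.norm_def, max_lt_iff,
      Real.norm_eq_abs, Real.norm_eq_abs]
    exact ⟨(abs_le_of_sq_le_sq (by nlinarith [sq_nonneg q.2]) hRpos.le).trans_lt (by linarith),
      (abs_le_of_sq_le_sq (by nlinarith [sq_nonneg q.1]) hRpos.le).trans_lt (by linarith)⟩
  set p : ℝ → ℝ → ℝ × ℝ := fun θ ρ => (ρ * Real.sin θ, ρ * Real.cos θ) with hp
  have hpn : ∀ θ ρ, (p θ ρ).1 ^ 2 + (p θ ρ).2 ^ 2 = ρ ^ 2 := by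
    intro θ ρ
    simp only [hp, mul_pow, ← mul_add, Real.sin_sq_add_cos_sq, mul_one]
  have hpS : ∀ θ ρ, 0 ≤ ρ → ρ ≤ R → p θ ρ ∈ S := fun θ ρ h1 h2 =>
    (hdisk _ (by rw [hpn]; gcongr)).1
  have hp0 : ∀ θ ρ, 0 < ρ → p θ ρ ≠ 0 := by
    intro θ ρ hρ h
    have := hpn θ ρ
    rw [h] at this
    simp only [Prod.fst_zero, Prod.snd_zero] at this
    nlinarith
  set a : ℝ → ℝ → ℝ := fun θ ρ => P (p θ ρ) * (ρ * Real.cos θ) - Q (p θ ρ) * (ρ * Real.sin θ)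
    with ha
  set b : ℝ → ℝ → ℝ := fun θ ρ => P (p θ ρ) * Real.sin θ + Q (p θ ρ) * Real.cos θ with hb
  have hbpos : ∀ θ ρ, 0 < ρ → ρ ≤ R → 0 < b θ ρ := by
    intro θ ρ h1 h2
    have := hrad _ (hpS θ ρ h1.le h2) (hp0 θ ρ h1)
    simp only [hp] at this
    refine pos_of_mul_pos_right (a := ρ) ?_ h1.le
    simp only [hb, hp]
    linarith
  have hst : ∀ θ ρ, 0 ≤ ρ → ρ ≤ R → HasStrictFDerivAt (fun z : ℝ × ℝ => H (p z.1 z.2))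
      (a θ ρ • ContinuousLinearMap.fst ℝ ℝ ℝ + b θ ρ • ContinuousLinearMap.snd ℝ ℝ ℝ) (θ, ρ) := by
    intro θ ρ h1 h2
    have e1 : HasStrictFDerivAt (fun z : ℝ × ℝ => Real.sin z.1)
        (Real.cos θ • ContinuousLinearMap.fst ℝ ℝ ℝ) (θ, ρ) :=
      (hasStrictFDerivAt_fst (𝕜 := ℝ) (p := ((θ, ρ) : ℝ × ℝ))).sin
    have e2 : HasStrictFDerivAt (fun z : ℝ × ℝ => Real.cos z.1)
        (-Real.sin θ • ContinuousLinearMap.fst ℝ ℝ ℝ) (θ, ρ) :=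
      (hasStrictFDerivAt_fst (𝕜 := ℝ) (p := ((θ, ρ) : ℝ × ℝ))).cos
    have e3 := (hasStrictFDerivAt_snd (𝕜 := ℝ) (p := ((θ, ρ) : ℝ × ℝ))).mul e1
    have e4 := (hasStrictFDerivAt_snd (𝕜 := ℝ) (p := ((θ, ρ) : ℝ × ℝ))).mul e2
    have e5 := (hH _ (hpS θ ρ h1 h2)).comp (θ, ρ) (e3.prodMk e4)
    refine e5.congr_fderiv ?_
    ext
    · simp [ha, hb, hp]
      ring
    · simp [ha, hb, hp]
  have hHc : ∀ θ, ContinuousOn (fun ρ => H (p θ ρ)) (Set.Icc 0 R) := by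
    intro θ ρ hρ
    have := (hst θ ρ hρ.1 hρ.2).continuousAt.comp (f := fun ρ : ℝ => ((θ, ρ) : ℝ × ℝ))
      (x := ρ) (by fun_prop)
    exact this.continuousWithinAt
  have hmono : ∀ θ, StrictMonoOn (fun ρ => H (p θ ρ)) (Set.Icc 0 R) := by
    intro θ
    refine strictMonoOn_of_deriv_pos (convex_Icc _ _) (hHc θ) fun ρ hρ => ?_
    rw [interior_Icc] at hρ
    have h2 : HasDerivAt (fun ρ => H (p θ ρ)) (b θ ρ) ρ :=
      ((hst θ ρ hρ.1.le hρ.2.le).hasFDerivAt.comp_hasDerivAt ρ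
        ((hasDerivAt_const ρ θ).prodMk (hasDerivAt_id ρ))).congr_deriv (by simp)
    rw [h2.deriv]
    exact hbpos θ ρ hρ.1 hρ.2.le
  have hHp0 : ∀ θ, H (p θ 0) = 0 := fun θ => by simp [hp, hH0]
  -- By compactness of the circle of radius `R`, every positive level below `m` is met exactly once
  -- on each ray, before radius `R`.
  obtain ⟨m, hm, hmle⟩ : ∃ m, 0 < m ∧ ∀ θ, m ≤ H (p θ R) := by
    have hc : Continuous fun θ => H (p θ R) := continuous_iff_continuousAt.2 fun θ =>
      (hst θ R hRpos.le le_rfl).continuousAt.comp (f := fun θ : ℝ => ((θ, R) : ℝ × ℝ))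
        (x := θ) (by fun_prop)
    have hper : Function.Periodic (fun θ => H (p θ R)) (2 * Real.pi) := fun θ => by
      simp [hp]
    obtain ⟨_, ⟨θ₀, rfl⟩, hle⟩ := (hper.compact_of_continuous (by positivity) hc).exists_isLeast
      (Set.range_nonempty _)
    refine ⟨_, ?_, fun θ => hle ⟨θ, rfl⟩⟩
    have := hmono θ₀ ⟨le_rfl, hRpos.le⟩ ⟨hRpos.le, le_rfl⟩ hRpos
    simpa [hHp0] using this
  have h00 : ((0, 0) : ℝ × ℝ) ∈ S := mem_of_mem_nhds hS
  refine ⟨{q | q.1 ^ 2 + q.2 ^ 2 < R ^ 2 ∧ H q < m}, ?_, ?_, ?_⟩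
  · refine Filter.inter_mem (s := {q : ℝ × ℝ | q.1 ^ 2 + q.2 ^ 2 < R ^ 2})
      (t := {q : ℝ × ℝ | H q < m}) ?_ ?_
    · refine (isOpen_lt (by fun_prop) (by fun_prop)).mem_nhds ?_
      simp [hRpos]
    · refine (hH _ h00).continuousAt.eventually_lt continuousAt_const ?_
      simpa [hH0] using hm
  · exact fun q hq => (hdisk q hq.1.le).2
  rintro q ⟨hq1, hq2⟩ hq0
  obtain ⟨θ₀, hθ₀⟩ := exists_polar q
  set ρ₀ := √(q.1 ^ 2 + q.2 ^ 2) with hρ₀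
  have hρ₀pos : 0 < ρ₀ := by
    rcases (Real.sqrt_nonneg (q.1 ^ 2 + q.2 ^ 2)).eq_or_lt with h | h
    · exact absurd (by rw [hθ₀, ← hρ₀.trans h.symm]; simp [hρ₀, ← h]) hq0
    · exact h
  have hρ₀R : ρ₀ < R := by
    rw [hρ₀, Real.sqrt_lt' hRpos]; exact hq1
  have hqp : q = p θ₀ ρ₀ := hθ₀
  have hE : 0 < H q := by
    have := hmono θ₀ ⟨le_rfl, hRpos.le⟩ ⟨hρ₀pos.le, hρ₀R.le⟩ hρ₀pos
    simp only [hHp0] at this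
    rwa [hqp]
  have hex : ∀ θ, ∃ ρ, (0 < ρ ∧ ρ < R) ∧ H (p θ ρ) = H q := by
    intro θ
    obtain ⟨ρ, hρ, hρe⟩ := intermediate_value_Icc hRpos.le (hHc θ)
      (show H q ∈ Set.Icc (H (p θ 0)) (H (p θ R)) from
        ⟨by rw [hHp0]; exact hE.le, hq2.le.trans (hmle θ)⟩)
    refine ⟨ρ, ⟨lt_of_le_of_ne hρ.1 ?_, lt_of_le_of_ne hρ.2 ?_⟩, hρe⟩
    · rintro rfl
      simp only [hHp0] at hρe
      exact hE.ne hρe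
    · rintro rfl
      have := hmle θ
      simp only at hρe
      linarith
  choose r hrI hrH using hex
  have huniq : ∀ θ ρ, 0 < ρ → ρ < R → H (p θ ρ) = H q → r θ = ρ := fun θ ρ h1 h2 h3 =>
    (hmono θ).injOn ⟨(hrI θ).1.le, (hrI θ).2.le⟩ ⟨h1.le, h2.le⟩ ((hrH θ).trans h3.symm)
  have hrd : ∀ θ, HasDerivAt r (-(a θ (r θ) / b θ (r θ))) θ := by
    intro θ
    refine hasDerivAt_of_implicit (hst θ (r θ) (hrI θ).1.le (hrI θ).2.le)
      (hbpos θ _ (hrI θ).1 (hrI θ).2.le).ne' rfl ?_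
    have : ∀ᶠ z : ℝ × ℝ in 𝓝 (θ, r θ), z.2 ∈ Set.Ioo 0 R :=
      continuousAt_snd.eventually (isOpen_Ioo.mem_nhds (hrI θ))
    filter_upwards [this] with z hz hz'
    exact huniq _ _ hz.1 hz.2 (hz'.trans (hrH θ))
  have hrc : Continuous r := continuous_iff_continuousAt.2 fun θ => (hrd θ).continuousAt
  have hrp : Function.Periodic r (2 * Real.pi) := fun θ => by
    refine huniq _ _ (hrI θ).1 (hrI θ).2 ?_
    rw [← hrH θ]; simp [hp]
  set c : ℝ → ℝ × ℝ := fun θ => p θ (r θ) with hc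
  have hcS : ∀ θ, c θ ∈ S := fun θ => hpS _ _ (hrI θ).1.le (hrI θ).2.le
  have hcc : Continuous c := by
    simp only [hc, hp]; fun_prop
  have hbc : ∀ θ, 0 < b θ (r θ) := fun θ => hbpos θ _ (hrI θ).1 (hrI θ).2.le
  -- The formula for `r'` gives `c' = (r / b) • (Q, -P)`, while `V = μ • (Q, -P)`.
  set ω : ℝ → ℝ := fun θ => r θ / (b θ (r θ) * μ (c θ)) with hω
  have hωc : Continuous ω := by
    have hPc : Continuous fun θ => P (c θ) := hP.comp_continuous hcc hcS
    have hQc : Continuous fun θ => Q (c θ) := hQ.comp_continuous hcc hcS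
    have hμc : Continuous fun θ => μ (c θ) := hμ.comp_continuous hcc hcS
    refine hrc.div (((hPc.mul Real.continuous_sin).add (hQc.mul Real.continuous_cos)).mul hμc)
      fun θ => ((mul_pos (hbc θ) (hμpos _ (hcS θ))).ne')
  have hcd : ∀ θ, HasDerivAt c (ω θ • V (c θ)) θ := by
    intro θ
    have h1 := ((hrd θ).mul (Real.hasDerivAt_sin θ)).prodMk
      ((hrd θ).mul (Real.hasDerivAt_cos θ))
    refine h1.congr_deriv ?_
    rw [hV _ (hcS θ)]
    have hb' := (hbc θ).ne'
    have hμ' := (hμpos _ (hcS θ)).ne'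
    have hsc := Real.sin_sq_add_cos_sq θ
    have hbe : b θ (r θ) = P (c θ) * Real.sin θ + Q (c θ) * Real.cos θ := rfl
    have hae : a θ (r θ) = P (c θ) * (r θ * Real.cos θ) - Q (c θ) * (r θ * Real.sin θ) := rfl
    ext
    · simp only [hω, Prod.smul_fst, smul_eq_mul]
      field_simp
      rw [hae, hbe]
      linear_combination Q (c θ) * r θ * hsc
    · simp only [hω, Prod.smul_snd, smul_eq_mul]
      field_simp
      rw [hae, hbe]
      linear_combination (-P (c θ)) * r θ * hsc
  have hcinj : ∀ s t, c s = c t → Real.cos (t - s) = 1 := by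
    intro s t hst'
    have h1 : r s ^ 2 = r t ^ 2 := by
      rw [← hpn s (r s), ← hpn t (r t)]
      simp only [hc] at hst'
      rw [hst']
    have h2 : r s = r t := by
      rwa [sq_eq_sq₀ (hrI s).1.le (hrI t).1.le] at h1
    simp only [hc, hp, h2, Prod.mk.injEq, mul_right_inj' (hrI t).1.ne'] at hst'
    rw [Real.cos_sub, hst'.1, hst'.2]
    nlinarith [Real.sin_sq_add_cos_sq t]
  obtain ⟨γ, hγ0, hγ, hγc⟩ := exists_isCycle_of_reparametrization (V := V) (c := c) (ω := ω) hωc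
    (fun θ => div_pos (hrI θ).1 (mul_pos (hbc θ) (hμpos _ (hcS θ))))
    (fun θ => by simp [hω, hb, hc, hp, hrp θ]) hcd (fun θ => by simp [hc, hp, hrp θ]) hcinj θ₀
  refine ⟨γ, _, ?_, hγ, fun t => ?_⟩
  · rw [hγ0, hc]
    simp only
    rw [huniq θ₀ ρ₀ hρ₀pos hρ₀R (by rw [← hqp]), ← hqp]
  · obtain ⟨θ, hθ⟩ := hγc t
    rw [hθ]
    refine ⟨?_, ?_⟩
    · rw [hc]
      simp only [hpn]
      exact pow_lt_pow_left₀ (hrI θ).2 (hrI θ).1.le two_ne_zero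
    · rw [hc]
      simp only [hrH]
      exact hq2

/-! ### The sign condition: sufficiency, and necessity for analytic `g` -/

theorem eq_zero_of_mul_pos {g : ℝ → ℝ} (hg : ContinuousAt g 0)
    (h : ∀ᶠ x in 𝓝[≠] (0 : ℝ), 0 < x * g x) : g 0 = 0 := by
  rw [← nhdsLT_sup_nhdsGT, Filter.eventually_sup] at h
  apply le_antisymm
  · refine le_of_tendsto (x := 𝓝[<] (0 : ℝ)) (hg.tendsto.mono_left nhdsWithin_le_nhds) ?_
    filter_upwards [h.1, self_mem_nhdsWithin] with x hx hx0
    exact (neg_of_mul_pos_right hx (le_of_lt hx0)).le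
  · refine ge_of_tendsto (x := 𝓝[>] (0 : ℝ)) (hg.tendsto.mono_left nhdsWithin_le_nhds) ?_
    filter_upwards [h.2, self_mem_nhdsWithin] with x hx hx0
    exact (pos_of_mul_pos_right hx (le_of_lt hx0)).le

theorem isCenter_of_mul_pos {N : Set ℝ} (ho : IsOpen N) (hc : N.OrdConnected)
    (h0 : (0 : ℝ) ∈ N) {f g : ℝ → ℝ} (hf : ContinuousOn f N) (hg : ContinuousOn g N)
    (hpos : ∀ x ∈ N, x ≠ 0 → 0 < x * g x) : IsCenter (lienardField f g) (0, 0) := by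
  have hN : N ∈ 𝓝 (0 : ℝ) := ho.mem_nhds h0
  have hg0 : g 0 = 0 := by
    refine eq_zero_of_mul_pos (hg.continuousAt hN) ?_
    filter_upwards [nhdsWithin_le_nhds hN, self_mem_nhdsWithin] with x hx hx0
    exact hpos x hx hx0
  have hF := continuousOn_primitiveF ho hc h0 hf
  have hE : ContinuousOn (fun x => Real.exp (2 * primitiveF f x)) N :=
    Real.continuous_exp.comp_continuousOn (continuousOn_const.mul hF)
  -- The radial derivative of the first integral is `e^{2F} (x g + (1 + x f) y²)`; this region keeps
  -- the coefficient of `y²` positive.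
  set S : Set (ℝ × ℝ) := {q | q.1 ∈ N ∧ -1 < q.1 * f q.1} with hS
  have hfst : ∀ {u : ℝ → ℝ}, ContinuousOn u N → ContinuousOn (fun q : ℝ × ℝ => u q.1) S :=
    fun hu => hu.comp continuousOn_fst fun q hq => hq.1
  refine isCenter_of_radially_increasing (S := S)
    (H := fun q => Real.exp (2 * primitiveF f q.1) * (q.2 ^ 2 / 2)
      + ∫ x in (0 : ℝ)..q.1, Real.exp (2 * primitiveF f x) * g x)
    (P := fun q => Real.exp (2 * primitiveF f q.1) * (f q.1 * q.2 ^ 2 + g q.1))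
    (Q := fun q => Real.exp (2 * primitiveF f q.1) * q.2)
    (μ := fun q => (Real.exp (2 * primitiveF f q.1))⁻¹)
    ?_ (by simp [lienardField, hg0]) (by simp) ?_ ?_ ?_ ?_ ?_ ?_ ?_
  · have h1 : ∀ᶠ x in 𝓝 (0 : ℝ), x ∈ N ∧ -1 < x * f x := by
      refine Filter.Eventually.and hN ?_
      have : ContinuousAt (fun x => x * f x) 0 := continuousAt_id.mul (hf.continuousAt hN)
      exact this.eventually (lt_mem_nhds (by norm_num))
    exact (continuousAt_fst (p := ((0, 0) : ℝ × ℝ))).eventually h1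
  · intro q hq
    have e1 := (hasStrictDerivAt_primitiveF ho hc h0 hf hq.1).comp_hasStrictFDerivAt q
      (hasStrictFDerivAt_fst (𝕜 := ℝ))
    have e2 := (hasStrictDerivAt_intervalIntegral_of_continuousOn ho hc h0
      (hE.mul hg) hq.1).comp_hasStrictFDerivAt q (hasStrictFDerivAt_fst (𝕜 := ℝ))
    have e3 := ((e1.const_mul 2).exp.mul
      (((hasStrictFDerivAt_snd (𝕜 := ℝ) (p := q)).pow 2).mul_const (2⁻¹ : ℝ))).add e2
    refine (e3.congr_fderiv ?_)
    ext
    · simp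
      ring
    · simp
  · exact (hfst hE).mul (((hfst hf).mul (by fun_prop)).add (hfst hg))
  · exact (hfst hE).mul (by fun_prop)
  · exact (hfst hE).inv₀ fun q _ => (Real.exp_pos _).ne'
  · exact fun q _ => inv_pos.2 (Real.exp_pos _)
  · intro q _
    have := (Real.exp_pos (2 * primitiveF f q.1)).ne'
    ext
    · simp [lienardField]
    · simp [lienardField]
      field_simp
      ring
  · intro q hq hq0
    have key : 0 < q.1 * g q.1 + (1 + q.1 * f q.1) * q.2 ^ 2 := by
      have h1 : 0 < 1 + q.1 * f q.1 := by linarith [hq.2]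
      by_cases hx : q.1 = 0
      · have hy : q.2 ≠ 0 := fun hy => hq0 (Prod.ext hx hy)
        rw [hx]
        have := pow_pos (abs_pos.2 hy) 2
        rw [sq_abs] at this
        linarith
      · have := hpos _ hq.1 hx
        positivity
    have := mul_pos (Real.exp_pos (2 * primitiveF f q.1)) key
    linarith

theorem exists_Ioo_subset_of_eventually {p : ℝ → Prop} (h : ∀ᶠ x in 𝓝 (0 : ℝ), p x) :
    ∃ δ > 0, ∀ x ∈ Set.Ioo (-δ) δ, p x := by
  obtain ⟨δ, hδ, h⟩ := Metric.eventually_nhds_iff.1 h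
  refine ⟨δ, hδ, fun x hx => h ?_⟩
  rw [Real.dist_eq, sub_zero]
  exact abs_lt.2 hx

theorem isCenter_of_eventually_mul_pos {N : Set ℝ} (ho : IsOpen N)
    (h0 : (0 : ℝ) ∈ N) {f g : ℝ → ℝ} (hf : ContinuousOn f N) (hg : ContinuousOn g N)
    (hpos : ∀ᶠ x in 𝓝[≠] (0 : ℝ), 0 < x * g x) : IsCenter (lienardField f g) (0, 0) := by
  obtain ⟨δ, hδ, h⟩ := exists_Ioo_subset_of_eventually
    ((ho.eventually_mem h0).and (eventually_nhdsWithin_iff.1 hpos))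
  exact isCenter_of_mul_pos isOpen_Ioo Set.ordConnected_Ioo ⟨by linarith, hδ⟩
    (hf.mono fun x hx => (h x hx).1) (hg.mono fun x hx => (h x hx).1)
    fun x hx hx0 => (h x hx).2 hx0

/-- If `w > 0`, the maximum would also be a local minimum, so `u` would be locally constant and `w`
would vanish. -/
theorem second_deriv_nonpos_of_forall_le {u v : ℝ → ℝ} {w t₀ : ℝ}
    (hu : ∀ t, HasDerivAt u (v t) t) (hv : HasDerivAt v w t₀) (hmax : ∀ t, u t ≤ u t₀) :
    v t₀ = 0 ∧ w ≤ 0 := by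
  have hd : deriv u = v := funext fun t => (hu t).deriv
  have h0 : v t₀ = 0 :=
    IsLocalMax.hasDerivAt_eq_zero (Filter.Eventually.of_forall hmax) (hu t₀)
  refine ⟨h0, ?_⟩
  by_contra! hw
  have hmin : IsLocalMin u t₀ := isLocalMin_of_deriv_deriv_pos (by rwa [hd, hv.deriv])
    (by rw [hd, h0]) (hu t₀).continuousAt
  have hconst : u =ᶠ[𝓝 t₀] fun _ => u t₀ := by
    filter_upwards [hmin] with t ht
    exact le_antisymm (hmax t) ht
  have h1 : v =ᶠ[𝓝 t₀] fun _ => 0 := by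
    have := hconst.deriv
    rw [hd] at this
    filter_upwards [this] with t ht
    simpa using ht
  exact hw.ne ((hasDerivAt_const t₀ (0 : ℝ)).congr_of_eventuallyEq h1 |>.unique hv)

theorem lienard_hasDerivAt {f g : ℝ → ℝ} {γ : ℝ → ℝ × ℝ} {t : ℝ}
    (h : HasDerivAt γ (lienardField f g (γ t)) t) :
    HasDerivAt (fun s => (γ s).1) (γ t).2 t ∧
      HasDerivAt (fun s => (γ s).2) (-g (γ t).1 - f (γ t).1 * (γ t).2 ^ 2) t :=
  ⟨(hasFDerivAt_fst (𝕜 := ℝ) (p := γ t)).comp_hasDerivAt t h,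
    (hasFDerivAt_snd (𝕜 := ℝ) (p := γ t)).comp_hasDerivAt t h⟩

theorem Function.Periodic.exists_forall_le {u : ℝ → ℝ} {T : ℝ} (hp : Function.Periodic u T)
    (hT : T ≠ 0) (hu : Continuous u) : ∃ t₀, ∀ t, u t ≤ u t₀ := by
  obtain ⟨_, ⟨t₀, rfl⟩, h⟩ := (hp.compact_of_continuous hT hu).exists_isGreatest
    (Set.range_nonempty _)
  exact ⟨t₀, fun t => h ⟨t, rfl⟩⟩

/-- The restoring force points inwards at the rightmost and the leftmost point of a cycle. -/
theorem exists_extremal_points {f g : ℝ → ℝ} {γ : ℝ → ℝ × ℝ} {T : ℝ}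
    (h : IsCycle (lienardField f g) γ T) :
    (∃ t₀, (∀ t, (γ t).1 ≤ (γ t₀).1) ∧ 0 ≤ g (γ t₀).1) ∧
      ∃ t₀, (∀ t, (γ t₀).1 ≤ (γ t).1) ∧ g (γ t₀).1 ≤ 0 := by
  obtain ⟨hd, hT, hp, -⟩ := h
  have h1 := fun t => (lienard_hasDerivAt (hd t)).1
  have h2 := fun t => (lienard_hasDerivAt (hd t)).2
  have hc : Continuous fun t => (γ t).1 := continuous_iff_continuousAt.2 fun t =>
    (h1 t).continuousAt
  have hp1 : Function.Periodic (fun t => (γ t).1) T := fun t => by simp [hp t]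
  constructor
  · obtain ⟨t₀, ht₀⟩ := hp1.exists_forall_le hT.ne' hc
    obtain ⟨e1, e2⟩ := second_deriv_nonpos_of_forall_le h1 (h2 t₀) ht₀
    refine ⟨t₀, ht₀, ?_⟩
    simp only [e1] at e2
    linarith
  · obtain ⟨t₀, ht₀⟩ := Function.Periodic.exists_forall_le (u := fun t => -(γ t).1)
      (fun t => by simp [hp t]) hT.ne' hc.neg
    obtain ⟨e1, e2⟩ := second_deriv_nonpos_of_forall_le (fun t => (h1 t).neg) (h2 t₀).neg ht₀
    refine ⟨t₀, fun t => neg_le_neg_iff.1 (ht₀ t), ?_⟩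
    have e3 : (γ t₀).2 = 0 := neg_eq_zero.1 e1
    simp only [e3] at e2
    linarith

/-- Where `g = 0` the quantity `e^F y` is conserved, so an orbit starting on the `x`-axis near `0`
never moves. -/
theorem not_isCenter_of_eventually_eq_zero {N : Set ℝ} (ho : IsOpen N) (hc : N.OrdConnected)
    (h0 : (0 : ℝ) ∈ N) {f g : ℝ → ℝ} (hf : ContinuousOn f N)
    (hg : ∀ᶠ x in 𝓝 (0 : ℝ), g x = 0) : ¬ IsCenter (lienardField f g) (0, 0) := by
  rintro ⟨-, hcen⟩
  have hW : {q : ℝ × ℝ | q.1 ∈ N ∧ g q.1 = 0} ∈ 𝓝 ((0, 0) : ℝ × ℝ) :=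
    (continuousAt_fst (p := ((0, 0) : ℝ × ℝ))).eventually
      ((ho.eventually_mem h0).and hg)
  obtain ⟨U, hU, hUW, horb⟩ := hcen _ hW
  have hline : ∀ᶠ x in 𝓝 (0 : ℝ), (x, (0 : ℝ)) ∈ U :=
    (show ContinuousAt (fun x : ℝ => (x, (0 : ℝ))) 0 by fun_prop).eventually hU
  obtain ⟨δ, hδ, hδU⟩ := exists_Ioo_subset_of_eventually hline
  obtain ⟨γ, T, hγ0, ⟨hd, hT, hp, hmin⟩, hγU⟩ := horb (δ / 2, 0)
    (hδU _ ⟨by linarith, by linarith⟩) (by simp [hδ.ne'])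
  have h1 := fun t => (lienard_hasDerivAt (hd t)).1
  have h2 := fun t => (lienard_hasDerivAt (hd t)).2
  have hconst : ∀ t, HasDerivAt
      (fun t => Real.exp (primitiveF f (γ t).1) * (γ t).2) 0 t := by
    intro t
    have hw := hUW (hγU t)
    have e := ((hasStrictDerivAt_primitiveF ho hc h0 hf hw.1).hasDerivAt.comp t (h1 t)).exp.mul
      (h2 t)
    refine e.congr_deriv ?_
    simp only [Function.comp_apply, hw.2]
    ring
  have hy : ∀ t, (γ t).2 = 0 := by
    intro t
    have := is_const_of_deriv_eq_zero (fun t => (hconst t).differentiableAt)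
      (fun t => (hconst t).deriv) t 0
    simpa [hγ0, (Real.exp_pos _).ne'] using this
  have hx : ∀ t s, (γ t).1 = (γ s).1 := is_const_of_deriv_eq_zero
    (fun t => (h1 t).differentiableAt) (fun t => by rw [(h1 t).deriv, hy])
  -- A constant orbit has every period, so no minimal one.
  have := hmin (T / 2) (by linarith) fun t =>
    Prod.ext (hx _ _) (by rw [hy, hy])
  linarith

/-- Zeros of `g` near `0` are isolated, so `g` has one sign on each side. A small cycle through a
point of the positive (negative) half-axis has its rightmost (leftmost) point on that side, which
fixes the sign there. -/
theorem eventually_mul_pos_of_isCenter {N : Set ℝ} (ho : IsOpen N) (hc : N.OrdConnected)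
    (h0 : (0 : ℝ) ∈ N) {f g : ℝ → ℝ} (hf : ContinuousOn f N) (hg : AnalyticOnNhd ℝ g N)
    (hcen : IsCenter (lienardField f g) (0, 0)) : ∀ᶠ x in 𝓝[≠] (0 : ℝ), 0 < x * g x := by
  rcases (hg 0 h0).eventually_eq_zero_or_eventually_ne_zero with hz | hnz
  · exact absurd hcen (not_isCenter_of_eventually_eq_zero ho hc h0 hf hz)
  obtain ⟨δ, hδ, h⟩ := exists_Ioo_subset_of_eventually
    ((ho.eventually_mem h0).and (eventually_nhdsWithin_iff.1 hnz))
  have hgc : ContinuousOn g (Set.Ioo (-δ) δ) :=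
    hg.continuousOn.mono fun x hx => (h x hx).1
  have hsign : ∀ s : Set ℝ, IsPreconnected s → s ⊆ Set.Ioo (-δ) δ → (0 : ℝ) ∉ s →
      ∀ a ∈ s, ∀ b ∈ s, g a < 0 → g b < 0 := by
    intro s hs hsub hs0 a ha b hb hga
    by_contra! hgb
    obtain ⟨x, hx, hx0⟩ := hs.intermediate_value ha hb (hgc.mono hsub) ⟨hga.le, hgb⟩
    exact (h x (hsub hx)).2 (by rintro rfl; exact hs0 hx) hx0
  have hW : {q : ℝ × ℝ | q.1 ∈ Set.Ioo (-δ) δ} ∈ 𝓝 ((0, 0) : ℝ × ℝ) :=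
    (continuousAt_fst (p := ((0, 0) : ℝ × ℝ))).eventually
      (isOpen_Ioo.mem_nhds ⟨by linarith, hδ⟩)
  obtain ⟨U, hU, hUW, horb⟩ := hcen.2 _ hW
  have hline : ∀ᶠ x in 𝓝 (0 : ℝ), (x, (0 : ℝ)) ∈ U :=
    (show ContinuousAt (fun x : ℝ => (x, (0 : ℝ))) 0 by fun_prop).eventually hU
  obtain ⟨η, hη, hηU⟩ := exists_Ioo_subset_of_eventually hline
  have hr : ∀ x ∈ Set.Ioo 0 δ, 0 < g x := by
    intro x hx
    by_contra! hgx
    have hgx' := lt_of_le_of_ne hgx ((h x ⟨by linarith [hx.1], hx.2⟩).2 hx.1.ne')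
    obtain ⟨γ, T, hγ0, hcyc, hγU⟩ := horb (η / 2, 0) (hηU _ ⟨by linarith, by linarith⟩)
      (by simp [hη.ne'])
    obtain ⟨t₀, ht₀, hgt⟩ := (exists_extremal_points hcyc).1
    have h1 := ht₀ 0
    rw [hγ0] at h1
    simp only at h1
    have := hsign (Set.Ioo 0 δ) isPreconnected_Ioo (Set.Ioo_subset_Ioo_left (by linarith))
      (by simp) x hx (γ t₀).1 ⟨by linarith, (hUW (hγU t₀)).2⟩ hgx'
    linarith
  have hl : ∀ x ∈ Set.Ioo (-δ) 0, g x < 0 := by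
    intro x hx
    obtain ⟨γ, T, hγ0, hcyc, hγU⟩ := horb (-(η / 2), 0) (hηU _ ⟨by linarith, by linarith⟩)
      (by simp [hη.ne'])
    obtain ⟨t₀, ht₀, hgt⟩ := (exists_extremal_points hcyc).2
    have h1 := ht₀ 0
    rw [hγ0] at h1
    simp only at h1
    have hm := hUW (hγU t₀)
    have hgt' := lt_of_le_of_ne hgt ((h _ hm).2 (show (γ t₀).1 ≠ 0 by linarith))
    exact hsign (Set.Ioo (-δ) 0) isPreconnected_Ioo (Set.Ioo_subset_Ioo_right hδ.le)
      (by simp) (γ t₀).1 ⟨hm.1, by linarith⟩ x hx hgt'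
  refine eventually_nhdsWithin_iff.2 ?_
  filter_upwards [Ioo_mem_nhds (show -δ < 0 by linarith) hδ] with x hx hx0
  rcases lt_or_gt_of_ne (hx0 : x ≠ 0) with hlt | hgt
  · exact mul_pos_of_neg_of_neg hlt (hl x ⟨hx.1, hlt⟩)
  · exact mul_pos hgt (hr x ⟨hgt, hx.2⟩)

/-! ### Injectivity of the Abel transform -/

/-- Area of a half-disk of radius `√s`; `√` is `0` on negative numbers, so the integrand vanishes
outside the diameter. -/
theorem integral_sqrt_sub_sq (s : ℝ) : ∫ x : ℝ, √(s - x ^ 2) = Real.pi / 2 * max s 0 := by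
  rcases le_or_gt s 0 with hs | hs
  · rw [max_eq_right hs]
    have : (fun x : ℝ => √(s - x ^ 2)) = fun _ => 0 := funext fun x =>
      Real.sqrt_eq_zero_of_nonpos (by nlinarith [sq_nonneg x])
    simp [this]
  · rw [max_eq_left hs.le]
    have ha : 0 < √s := Real.sqrt_pos.2 hs
    have hsq : √s ^ 2 = s := Real.sq_sqrt hs.le
    have h1 : ∫ x : ℝ, √(1 - x ^ 2) = Real.pi / 2 := by
      rw [← integral_sqrt_one_sub_sq, intervalIntegral.integral_of_le (by norm_num)]
      refine (MeasureTheory.setIntegral_eq_integral_of_forall_compl_eq_zero fun x hx => ?_).symm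
      refine Real.sqrt_eq_zero_of_nonpos ?_
      by_contra! h
      have := abs_lt_of_sq_lt_sq (show x ^ 2 < 1 ^ 2 by linarith) (by norm_num)
      exact hx ⟨(abs_lt.1 this).1, (abs_lt.1 this).2.le⟩
    have h2 := MeasureTheory.Measure.integral_comp_mul_left (fun x : ℝ => √(s - x ^ 2)) (√s)
    have h3 : ∀ x : ℝ, √(s - (√s * x) ^ 2) = √s * √(1 - x ^ 2) := fun x => by
      rw [← Real.sqrt_mul hs.le, mul_pow, hsq]; congr 1; ring
    simp only [h3, MeasureTheory.integral_const_mul, h1, smul_eq_mul, abs_inv, abs_of_pos ha] at h2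
    have : ∫ x : ℝ, √(s - x ^ 2) = √s ^ 2 * (Real.pi / 2) := by
      field_simp at h2
      linarith
    rw [this, hsq, mul_comm]

/-- The integral of `n(y) √(B² - x² - y²)` over the plane is computed twice. Polar coordinates give
`0` by hypothesis; integrating out `x` first gives `π/2` times the claimed integral. -/
theorem integral_mul_sq_sub_sq_eq_zero {n : ℝ → ℝ} (hn : Continuous n) {B : ℝ} (hB : 0 < B)
    (h : ∀ A ∈ Set.Ioo 0 B, ∫ θ in (-Real.pi)..Real.pi, n (A * Real.sin θ) = 0) :
    ∫ y in (-B)..B, n y * (B ^ 2 - y ^ 2) = 0 := by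
  set F : ℝ × ℝ → ℝ := fun p => n p.2 * √(B ^ 2 - p.2 ^ 2 - p.1 ^ 2) with hF
  have hFc : Continuous F := by fun_prop
  have hFs : HasCompactSupport F := by
    refine HasCompactSupport.intro
      (K := Set.Icc (-B) B ×ˢ Set.Icc (-B) B) (isCompact_Icc.prod isCompact_Icc) fun p hp => ?_
    rw [hF]
    simp only
    rw [Real.sqrt_eq_zero_of_nonpos, mul_zero]
    by_contra! hlt
    refine hp ⟨abs_le.1 (abs_le_of_sq_le_sq ?_ hB.le), abs_le.1 (abs_le_of_sq_le_sq ?_ hB.le)⟩ <;>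
      nlinarith [sq_nonneg p.1, sq_nonneg p.2]
  have hcart : ∫ p, F p = Real.pi / 2 * ∫ y in (-B)..B, n y * (B ^ 2 - y ^ 2) := by
    have hi : MeasureTheory.Integrable F := hFc.integrable_of_hasCompactSupport hFs
    rw [MeasureTheory.Measure.volume_eq_prod] at hi ⊢
    rw [MeasureTheory.integral_prod_symm _ hi]
    simp only [hF, MeasureTheory.integral_const_mul, integral_sqrt_sub_sq]
    rw [← intervalIntegral.integral_const_mul, intervalIntegral.integral_of_le (by linarith),
      ← MeasureTheory.setIntegral_eq_integral_of_forall_compl_eq_zero (s := Set.Ioc (-B) B)]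
    · refine MeasureTheory.setIntegral_congr_fun measurableSet_Ioc fun y hy => ?_
      have : 0 ≤ B ^ 2 - y ^ 2 := by
        have := sq_le_sq' hy.1.le hy.2
        linarith
      simp only [max_eq_left this]
      ring
    · intro y hy
      rw [max_eq_right, mul_zero, mul_zero]
      by_contra! hlt
      have := abs_lt.1 (abs_lt_of_sq_lt_sq (show y ^ 2 < B ^ 2 by linarith) hB.le)
      exact hy ⟨this.1, this.2.le⟩
  have hpolar : ∫ p, F p = 0 := by
    rw [← integral_comp_polarCoord_symm]
    set P : ℝ × ℝ → ℝ := fun p => p.1 * (n (p.1 * Real.sin p.2) * √(B ^ 2 - p.1 ^ 2)) with hP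
    have hFP : ∀ p : ℝ × ℝ, p.1 • F (polarCoord.symm p) = P p := by
      intro p
      simp only [hF, hP, polarCoord_symm_apply, smul_eq_mul]
      congr 3
      nlinarith [Real.sin_sq_add_cos_sq p.2]
    simp only [hFP]
    have hPc : Continuous P := by fun_prop
    have hzero : ∀ p : ℝ × ℝ, B ≤ p.1 → P p = 0 := by
      intro p hp
      simp only [hP]
      rw [Real.sqrt_eq_zero_of_nonpos (by nlinarith)]
      ring
    have hint : MeasureTheory.IntegrableOn P (Set.Ioi 0 ×ˢ Set.Ioo (-Real.pi) Real.pi) := by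
      refine MeasureTheory.IntegrableOn.of_forall_sdiff_eq_zero
        (s := Set.Icc 0 B ×ˢ Set.Icc (-Real.pi) Real.pi)
        (hPc.continuousOn.integrableOn_compact (isCompact_Icc.prod isCompact_Icc))
        (measurableSet_Ioi.prod measurableSet_Ioo) fun p hp => hzero p ?_
      by_contra! hlt
      exact hp.2 ⟨⟨le_of_lt hp.1.1, hlt.le⟩, Set.Ioo_subset_Icc_self hp.1.2⟩
    rw [polarCoord_target, MeasureTheory.Measure.volume_eq_prod,
      MeasureTheory.setIntegral_prod _ (by rwa [← MeasureTheory.Measure.volume_eq_prod])]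
    refine MeasureTheory.setIntegral_eq_zero_of_forall_eq_zero fun r hr => ?_
    rcases lt_or_ge r B with hrB | hrB
    · have := h r ⟨hr, hrB⟩
      rw [intervalIntegral.integral_of_le (by linarith [Real.pi_pos]),
        MeasureTheory.integral_Ioc_eq_integral_Ioo] at this
      simp only [hP]
      rw [MeasureTheory.integral_const_mul, MeasureTheory.integral_mul_const, this]
      ring
    · simp [hzero (r, _) hrB]
  rw [hpolar] at hcart
  have := Real.pi_pos
  exact (mul_eq_zero.1 hcart.symm).resolve_left (by positivity)

/-- Injectivity of the Abel transform, in angular form: only the odd part of `n` is invisible to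
the averages of `n (A sin θ)`. -/
theorem add_neg_eq_zero_of_integral_sin_eq_zero {n : ℝ → ℝ} (hn : Continuous n) {δ : ℝ}
    (h : ∀ A ∈ Set.Ioo 0 δ, ∫ θ in (-Real.pi)..Real.pi, n (A * Real.sin θ) = 0) :
    ∀ B ∈ Set.Ioo 0 δ, n B + n (-B) = 0 := by
  set p : ℝ → ℝ := fun x => n x + n (-x) with hp
  have hpc : Continuous p := by fun_prop
  have hfold : ∀ B ∈ Set.Ioo 0 δ, ∫ y in (0 : ℝ)..B, p y * (B ^ 2 - y ^ 2) = 0 := by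
    intro B hB
    have h0 := integral_mul_sq_sub_sq_eq_zero hn hB.1 fun A hA => h A ⟨hA.1, hA.2.trans hB.2⟩
    set w : ℝ → ℝ := fun y => n y * (B ^ 2 - y ^ 2) with hw
    have hwc : Continuous w := by fun_prop
    have e1 := intervalIntegral.integral_add_adjacent_intervals
      (hwc.intervalIntegrable (μ := MeasureTheory.volume) (-B) 0) (hwc.intervalIntegrable 0 B)
    have e2 := intervalIntegral.integral_comp_neg (a := 0) (b := B) w
    rw [neg_zero] at e2
    have e3 := intervalIntegral.integral_add (μ := MeasureTheory.volume)
      (hwc.intervalIntegrable 0 B) ((hwc.comp continuous_neg).intervalIntegrable 0 B)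
    have e4 : ∀ y, p y * (B ^ 2 - y ^ 2) = w y + (w ∘ Neg.neg) y := fun y => by
      simp only [hp, hw, Function.comp_apply]; ring
    simp only [e4]
    rw [e3]
    simp only [Function.comp_apply]
    rw [e2]
    linarith
  have hd1 : ∀ B, HasDerivAt (fun B => ∫ y in (0 : ℝ)..B, p y) (p B) B := fun B =>
    (hpc.integral_hasStrictDerivAt 0 B).hasDerivAt
  have hd2 : ∀ B, HasDerivAt (fun B => ∫ y in (0 : ℝ)..B, p y * y ^ 2) (p B * B ^ 2) B :=
    fun B => ((hpc.mul (continuous_pow 2)).integral_hasStrictDerivAt 0 B).hasDerivAt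
  have hderiv_zero : ∀ {u : ℝ → ℝ} {u' B : ℝ}, B ∈ Set.Ioo 0 δ → HasDerivAt u u' B →
      (∀ B ∈ Set.Ioo 0 δ, u B = 0) → u' = 0 := fun {u u' B} hB hu hz =>
    hu.unique ((hasDerivAt_const B (0 : ℝ)).congr_of_eventuallyEq
      (Filter.eventually_of_mem (isOpen_Ioo.mem_nhds hB) hz))
  have hN1 : ∀ B ∈ Set.Ioo 0 δ, ∫ y in (0 : ℝ)..B, p y = 0 := by
    intro B hB
    -- Differentiating `B² ∫ p - ∫ p y²` in `B` cancels the boundary terms and leaves `2B ∫ p`; one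
    -- more derivative gives `p B = 0`.
    have hd := (((hasDerivAt_id B).pow 2).mul (hd1 B)).sub (hd2 B)
    have := hderiv_zero hB hd fun C hC => by
      have e := hfold C hC
      simp only [mul_sub] at e
      rw [intervalIntegral.integral_sub
        ((show Continuous fun y => p y * C ^ 2 by fun_prop).intervalIntegrable _ _)
        ((show Continuous fun y => p y * y ^ 2 by fun_prop).intervalIntegrable _ _),
        intervalIntegral.integral_mul_const] at e
      simp only [Pi.sub_apply, Pi.mul_apply, Pi.pow_apply, id]
      linarith
    simp only [Pi.pow_apply, id] at this
    norm_num at this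
    have h2 : 2 * B * ∫ y in (0 : ℝ)..B, p y = 0 := by linarith
    exact (mul_eq_zero.1 h2).resolve_left (by linarith [hB.1])
  exact fun B hB => hderiv_zero hB (hd1 B) hN1

/-! ### Explicit cycles and isochronicity -/

/-- Explicit cycles of the equation with `g x = K x e^{-2F(x)}`. -/
theorem exists_isCycle_of_amplitude {N : Set ℝ} (ho : IsOpen N) (hc : N.OrdConnected)
    (h0 : (0 : ℝ) ∈ N) {f g : ℝ → ℝ} (hf : ContinuousOn f N) {K : ℝ} (hK : 0 < K)
    (hg : ∀ x ∈ N, g x = K * (x / Real.exp (2 * primitiveF f x))) {A : ℝ} (hA : 0 < A)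
    (hAN : Set.Icc (-A) A ⊆ N) (θ₀ : ℝ) :
    ∃ γ, γ 0 = (A * Real.sin θ₀,
        A * √K * Real.cos θ₀ * Real.exp (-primitiveF f (A * Real.sin θ₀))) ∧
      IsCycle (lienardField f g) γ
        (∫ θ in (0 : ℝ)..(2 * Real.pi), Real.exp (primitiveF f (A * Real.sin θ)) / √K) ∧
      ∀ t, (γ t).1 ∈ N := by
  have hsK : 0 < √K := Real.sqrt_pos.2 hK
  have hsq : √K ^ 2 = K := Real.sq_sqrt hK.le
  have hmem : ∀ θ, A * Real.sin θ ∈ N := fun θ => hAN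
    ⟨by nlinarith [Real.neg_one_le_sin θ], by nlinarith [Real.sin_le_one θ]⟩
  have hd : ∀ θ, HasDerivAt (fun θ => A * Real.sin θ) (A * Real.cos θ) θ := fun θ =>
    (Real.hasDerivAt_sin θ).const_mul A
  have hFd : ∀ θ, HasDerivAt (fun θ => primitiveF f (A * Real.sin θ))
      (f (A * Real.sin θ) * (A * Real.cos θ)) θ := fun θ =>
    HasDerivAt.comp (h₂ := primitiveF f) θ
      (hasStrictDerivAt_primitiveF ho hc h0 hf (hmem θ)).hasDerivAt (hd θ)
  have hFc : Continuous fun θ => primitiveF f (A * Real.sin θ) :=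
    continuous_iff_continuousAt.2 fun θ => (hFd θ).continuousAt
  obtain ⟨γ, hγ0, hγ, hγc⟩ := exists_isCycle_of_reparametrization (V := lienardField f g)
    (c := fun θ => (A * Real.sin θ,
      A * √K * Real.cos θ * Real.exp (-primitiveF f (A * Real.sin θ))))
    (ω := fun θ => Real.exp (primitiveF f (A * Real.sin θ)) / √K)
    (by fun_prop) (fun θ => by positivity) (fun θ => by simp) (fun θ => by
      have h2 := ((Real.hasDerivAt_cos θ).const_mul (A * √K)).mul (hFd θ).neg.exp
      refine ((hd θ).prodMk h2).congr_deriv ?_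
      have hE : Real.exp (-primitiveF f (A * Real.sin θ))
          = (Real.exp (primitiveF f (A * Real.sin θ)))⁻¹ := Real.exp_neg _
      have hE2 : Real.exp (2 * primitiveF f (A * Real.sin θ))
          = Real.exp (primitiveF f (A * Real.sin θ)) ^ 2 := by rw [← Real.exp_nat_mul]; norm_num
      have hne := (Real.exp_pos (primitiveF f (A * Real.sin θ))).ne'
      simp only [lienardField, hg _ (hmem θ), Pi.neg_apply, hE, hE2, Prod.smul_mk, smul_eq_mul, Prod.mk.injEq]
      constructor
      · field_simp
      · field_simp
        rw [hsq]
        ring) (fun θ => by simp) (fun a b hab => by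
      simp only [Prod.mk.injEq] at hab
      have hs : Real.sin a = Real.sin b := mul_left_cancel₀ hA.ne' hab.1
      rw [hs] at hab
      have hcos : Real.cos a = Real.cos b := mul_left_cancel₀ (mul_pos hA hsK).ne'
        (mul_right_cancel₀ (Real.exp_pos _).ne' hab.2)
      rw [Real.cos_sub, hs, hcos]
      nlinarith [Real.sin_sq_add_cos_sq b]) θ₀
  refine ⟨γ, hγ0, hγ, fun t => ?_⟩
  obtain ⟨θ, hθ⟩ := hγc t
  rw [hθ]
  exact hmem θ

theorem isIsochronousCenter_of_exp_add_exp {N : Set ℝ} (ho : IsOpen N) (hc : N.OrdConnected)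
    (h0 : (0 : ℝ) ∈ N) {f g : ℝ → ℝ} (hf : ContDiffOn ℝ 1 f N) (hgc : ContDiffOn ℝ 1 g N)
    {K : ℝ} (hK : 0 < K) (hg : ∀ x ∈ N, g x = K * (x / Real.exp (2 * primitiveF f x)))
    (hsum : ∀ x ∈ N, Real.exp (primitiveF f x) + Real.exp (primitiveF f (-x)) = 2) :
    IsIsochronousCenter (lienardField f g) (0, 0) := by
  refine ⟨isCenter_of_mul_pos ho hc h0 hf.continuousOn hgc.continuousOn fun x hx hx0 => ?_, ?_⟩
  · rw [hg x hx, show x * (K * (x / Real.exp (2 * primitiveF f x)))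
      = K * x ^ 2 / Real.exp (2 * primitiveF f x) by ring]
    positivity
  have hsK : 0 < √K := Real.sqrt_pos.2 hK
  obtain ⟨δ, hδ, hδN⟩ := exists_Ioo_subset_of_eventually (ho.eventually_mem h0)
  have hFa : ContinuousAt (fun q : ℝ × ℝ => primitiveF f q.1) (0, 0) :=
    ContinuousAt.comp (g := primitiveF f) (f := fun q : ℝ × ℝ => q.1) (x := ((0, 0) : ℝ × ℝ))
      (hasStrictDerivAt_primitiveF ho hc h0 hf.continuousOn h0).hasDerivAt.continuousAt
      continuousAt_fst
  have hU : ∀ᶠ q : ℝ × ℝ in 𝓝 (0, 0),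
      q.1 ^ 2 + (q.2 * Real.exp (primitiveF f q.1) / √K) ^ 2 < δ ^ 2 := by
    have : ContinuousAt (fun q : ℝ × ℝ =>
        q.1 ^ 2 + (q.2 * Real.exp (primitiveF f q.1) / √K) ^ 2) (0, 0) :=
      (continuousAt_fst.pow 2).add
        (((continuousAt_snd.mul hFa.rexp).div_const _).pow 2)
    refine this.eventually_lt continuousAt_const ?_
    simp [hδ]
  refine ⟨2 * Real.pi / √K, _, hU, fun q hq hq0 γ S hγ0 hγ => ?_⟩
  -- Amplitude and phase of `q` in the coordinates `(x, e^F y / √K)`, in which orbits are circles.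
  obtain ⟨θ₀, hθ₀⟩ := exists_polar (q.1, q.2 * Real.exp (primitiveF f q.1) / √K)
  simp only at hθ₀
  set A := √(q.1 ^ 2 + (q.2 * Real.exp (primitiveF f q.1) / √K) ^ 2) with hA
  rw [Prod.mk.injEq] at hθ₀
  have hy : q.2 = A * √K * Real.cos θ₀ * Real.exp (-primitiveF f q.1) := by
    rw [Real.exp_neg]
    have h1 := hθ₀.2
    have := (Real.exp_pos (primitiveF f q.1)).ne'
    field_simp at h1 ⊢
    linarith
  have hApos : 0 < A := by
    rcases (Real.sqrt_nonneg _).eq_or_lt with h | h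
    · refine absurd (Prod.ext (x := q) (y := 0) ?_ ?_) hq0
      · rw [hθ₀.1, hA, ← h]; simp
      · rw [hy, hA, ← h]; simp
    · exact h
  have hAδ : A < δ := (Real.sqrt_lt' hδ).2 hq
  have hAN : Set.Icc (-A) A ⊆ N := fun x hx => hδN x ⟨by linarith [hx.1], by linarith [hx.2]⟩
  obtain ⟨γ', hγ'0, hγ', hγ'N⟩ := exists_isCycle_of_amplitude ho hc h0 hf.continuousOn hK hg hApos
    hAN θ₀
  have heq : γ' = γ := solution_unique_of_contDiffAt
    (fun t => contDiffAt_lienardField ho hf hgc (hγ'N t)) hγ'.1 hγ.1 (by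
      rw [hγ0, hγ'0, ← hθ₀.1, ← hy])
  rw [heq] at hγ'
  rw [hγ.period_unique hγ']
  have hmem : ∀ θ, A * Real.sin θ ∈ N := fun θ => hAN
    ⟨by nlinarith [Real.neg_one_le_sin θ], by nlinarith [Real.sin_le_one θ]⟩
  set m : ℝ → ℝ := fun θ => Real.exp (primitiveF f (A * Real.sin θ)) with hm
  have hmc : Continuous m := Real.continuous_exp.comp
    ((continuousOn_primitiveF ho hc h0 hf.continuousOn).comp_continuous (by fun_prop) hmem)
  rw [intervalIntegral.integral_div]
  congr 1
  have e1 := intervalIntegral.integral_add_adjacent_intervals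
    (hmc.intervalIntegrable (μ := MeasureTheory.volume) 0 Real.pi)
    (hmc.intervalIntegrable Real.pi (2 * Real.pi))
  have e2 := intervalIntegral.integral_comp_add_right (a := 0) (b := Real.pi) m Real.pi
  rw [zero_add, ← two_mul] at e2
  have e3 := intervalIntegral.integral_add (μ := MeasureTheory.volume)
    (hmc.intervalIntegrable 0 Real.pi)
    ((show Continuous fun θ => m (θ + Real.pi) by fun_prop).intervalIntegrable 0 Real.pi)
  -- A half turn changes the sign of `A sin θ`, which is where the functional equation enters.
  have e4 : ∀ θ, m θ + m (θ + Real.pi) = 2 := fun θ => by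
    simp only [hm, Real.sin_add_pi, mul_neg]
    exact hsum _ (hmem θ)
  simp only [e4, intervalIntegral.integral_const, smul_eq_mul] at e3
  rw [← e1, ← e2, ← e3]
  ring

theorem eventually_exp_add_exp_of_isIsochronousCenter {N : Set ℝ} (ho : IsOpen N)
    (hc : N.OrdConnected) (h0 : (0 : ℝ) ∈ N) {f g : ℝ → ℝ} (hf : ContinuousOn f N)
    {K : ℝ} (hK : 0 < K) (hg : ∀ x ∈ N, g x = K * (x / Real.exp (2 * primitiveF f x)))
    (hiso : IsIsochronousCenter (lienardField f g) (0, 0)) :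
    ∃ δ > 0, ∀ x ∈ Set.Ioo 0 δ,
      Real.exp (primitiveF f x) + Real.exp (primitiveF f (-x)) = 2 := by
  obtain ⟨-, T, U, hU, hT⟩ := hiso
  have hsK : 0 < √K := Real.sqrt_pos.2 hK
  have hline : ∀ᶠ A in 𝓝 (0 : ℝ), ((0 : ℝ), A * √K) ∈ U :=
    (show ContinuousAt (fun A : ℝ => ((0 : ℝ), A * √K)) 0 by fun_prop) (by simpa using hU)
  obtain ⟨η, hη, h⟩ := exists_Ioo_subset_of_eventually ((ho.eventually_mem h0).and hline)
  set δ := η / 2 with hδ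
  have hδpos : 0 < δ := by positivity
  have hsub : Set.Icc (-δ) δ ⊆ N := fun x hx =>
    (h x ⟨by linarith [hx.1], by linarith [hx.2]⟩).1
  set m : ℝ → ℝ := fun x => Real.exp (primitiveF f x) with hm
  have hmc : ContinuousOn m (Set.Icc (-δ) δ) :=
    Real.continuous_exp.comp_continuousOn ((continuousOn_primitiveF ho hc h0 hf).mono hsub)
  -- The Abel argument needs a function continuous on all of `ℝ`, so `m` is extended by constants.
  set M : ℝ → ℝ := Set.IccExtend (show -δ ≤ δ by linarith) ((Set.Icc (-δ) δ).domRestrict m) with hM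
  have hMc : Continuous M := hmc.domRestrict.Icc_extend'
  have hMm : ∀ x ∈ Set.Icc (-δ) δ, M x = m x := fun x hx => Set.IccExtend_of_mem _ _ hx
  have hper : ∀ A ∈ Set.Ioo 0 δ,
      ∫ θ in (0 : ℝ)..(2 * Real.pi), M (A * Real.sin θ) = T * √K := by
    intro A hA
    obtain ⟨γ, hγ0, hγ, -⟩ := exists_isCycle_of_amplitude ho hc h0 hf hK hg hA.1
      ((Set.Icc_subset_Icc (by linarith [hA.2]) hA.2.le).trans hsub) 0
    have := hT (0, A * √K) (h A ⟨by linarith [hA.1], by linarith [hA.2]⟩).2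
      (by simp [hA.1.ne', hsK.ne']) γ _ (by simpa using hγ0) hγ
    rw [← this, intervalIntegral.integral_div, div_mul_cancel₀ _ hsK.ne']
    refine intervalIntegral.integral_congr fun θ _ => hMm _
      ⟨by nlinarith [Real.neg_one_le_sin θ, hA.1, hA.2],
        by nlinarith [Real.sin_le_one θ, hA.1, hA.2]⟩
  have hΦ : Continuous fun A : ℝ => ∫ θ in (0 : ℝ)..(2 * Real.pi), M (A * Real.sin θ) :=
    intervalIntegral.continuous_parametric_intervalIntegral_of_continuous' (by fun_prop) _ _
  have hM0 : M 0 = 1 := by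
    rw [hMm 0 ⟨by linarith, hδpos.le⟩]; simp [hm]
  -- The constant period is identified by letting `A → 0`, where the integrand tends to `1`.
  have hTK : 2 * Real.pi = T * √K := by
    have h1 : Filter.Tendsto (fun A : ℝ => ∫ θ in (0 : ℝ)..(2 * Real.pi), M (A * Real.sin θ))
        (𝓝[>] 0) (𝓝 (2 * Real.pi)) := by
      have := (hΦ.tendsto 0).mono_left (nhdsWithin_le_nhds (s := Set.Ioi 0))
      simpa [hM0] using this
    refine tendsto_nhds_unique h1 (tendsto_const_nhds.congr' ?_)
    filter_upwards [Ioo_mem_nhdsGT hδpos] with A hA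
    exact (hper A hA).symm
  refine ⟨δ, hδpos, fun x hx => ?_⟩
  have key := add_neg_eq_zero_of_integral_sin_eq_zero (n := fun x => M x - 1) (by fun_prop)
    (δ := δ) (fun A hA => ?_) x hx
  · rw [hMm x ⟨by linarith [hx.1], hx.2.le⟩,
      hMm (-x) ⟨by linarith [hx.2], by linarith [hx.1]⟩] at key
    simp only [hm] at key
    linarith
  · have hc1 : Continuous fun θ => M (A * Real.sin θ) := by fun_prop
    rw [intervalIntegral.integral_sub (hc1.intervalIntegrable _ _)
      (continuous_const.intervalIntegrable _ _)]
    have hp : Function.Periodic (fun θ => M (A * Real.sin θ)) (2 * Real.pi) := fun θ => by simp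
    have e := hp.intervalIntegral_add_eq (-Real.pi) 0
    rw [show -Real.pi + 2 * Real.pi = Real.pi by ring, zero_add, hper A hA] at e
    rw [e, intervalIntegral.integral_const]
    simp only [smul_eq_mul]
    linarith

/-! ### Odd `g` and the main theorem -/

theorem primitiveF_neg_of_odd {N : Set ℝ} {f g : ℝ → ℝ} {K : ℝ} (hK : 0 < K)
    (hsymm : ∀ x ∈ N, -x ∈ N)
    (hg : ∀ x ∈ N, g x = K * (x / Real.exp (2 * primitiveF f x)))
    (hodd : ∀ x ∈ N, g (-x) = -g x) {x : ℝ} (hx : x ∈ N) :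
    primitiveF f (-x) = primitiveF f x := by
  rcases eq_or_ne x 0 with rfl | hx0
  · simp
  have h := hodd x hx
  rw [hg x hx, hg _ (hsymm x hx)] at h
  have e1 := (Real.exp_pos (2 * primitiveF f x)).ne'
  have e2 := (Real.exp_pos (2 * primitiveF f (-x))).ne'
  field_simp at h
  have := Real.exp_injective (neg_injective h)
  linarith

/-- Oddness of `g` makes `F` even, so the functional equation reads `2 e^F = 2` and `F` vanishes. -/
theorem eq_zero_of_odd_of_exp_add_exp {N : Set ℝ} (ho : IsOpen N) (hc : N.OrdConnected)
    (h0 : (0 : ℝ) ∈ N) {f g : ℝ → ℝ} (hf : ContinuousOn f N) {K : ℝ} (hK : 0 < K)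
    (hsymm : ∀ x ∈ N, -x ∈ N)
    (hg : ∀ x ∈ N, g x = K * (x / Real.exp (2 * primitiveF f x)))
    (hodd : ∀ x ∈ N, g (-x) = -g x)
    (hsum : ∀ x ∈ N, Real.exp (primitiveF f x) + Real.exp (primitiveF f (-x)) = 2) :
    ∀ x ∈ N, f x = 0 ∧ g x = K * x := by
  have hF : ∀ x ∈ N, primitiveF f x = 0 := fun x hx => by
    have := hsum x hx
    rw [primitiveF_neg_of_odd hK hsymm hg hodd hx] at this
    exact (Real.exp_eq_one_iff _).1 (by linarith)
  intro x hx
  refine ⟨?_, by rw [hg x hx, hF x hx]; simp⟩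
  exact (hasStrictDerivAt_primitiveF ho hc h0 hf hx).hasDerivAt.unique
    ((hasDerivAt_const x (0 : ℝ)).congr_of_eventuallyEq
      (Filter.eventually_of_mem (ho.mem_nhds hx) hF))

theorem mainTheorem7 (N₀ : Set ℝ) (hopen : IsOpen N₀) (hconn : N₀.OrdConnected)
    (h0 : (0 : ℝ) ∈ N₀) (f g : ℝ → ℝ)
    (hf : ContDiffOn ℝ 1 f N₀) (hg : ContDiffOn ℝ 1 g N₀) :
    -- `x g(x) > 0` implies a center
    ((∀ x ∈ N₀, x ≠ 0 → 0 < x * g x) → IsCenter (lienardField f g) (0, 0)) ∧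
    -- for analytic `g` the sign condition near `0` is also necessary
    (AnalyticOnNhd ℝ g N₀ →
      (IsCenter (lienardField f g) (0, 0) ↔ ∀ᶠ x in 𝓝[≠] (0 : ℝ), 0 < x * g x)) ∧
    ∀ K : ℝ, 0 < K → (∀ x ∈ N₀, -x ∈ N₀) →
      (∀ x ∈ N₀, g x = K * (x / Real.exp (2 * primitiveF f x))) →
      -- the functional equation implies isochronicity
      ((∀ x ∈ N₀, Real.exp (primitiveF f x) + Real.exp (primitiveF f (-x)) = 2) →
        IsIsochronousCenter (lienardField f g) (0, 0)) ∧
      -- if in addition `g` is odd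
      ((∀ x ∈ N₀, Real.exp (primitiveF f x) + Real.exp (primitiveF f (-x)) = 2) →
        (∀ x ∈ N₀, g (-x) = -g x) →
        (IsIsochronousCenter (lienardField f g) (0, 0) ↔
          ∀ x ∈ N₀, f x = 0 ∧ g x = K * x)) ∧
      -- for odd `g` the equivalence holds near `0` even without the functional equation
      ((∀ x ∈ N₀, g (-x) = -g x) →
        (IsIsochronousCenter (lienardField f g) (0, 0) ↔
          ∀ᶠ x in 𝓝 (0 : ℝ), f x = 0 ∧ g x = K * x)) := by
  refine ⟨isCenter_of_mul_pos hopen hconn h0 hf.continuousOn hg.continuousOn,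
    fun han => ⟨eventually_mul_pos_of_isCenter hopen hconn h0 hf.continuousOn han,
      isCenter_of_eventually_mul_pos hopen h0 hf.continuousOn hg.continuousOn⟩,
    fun K hK hsymm hgK => ⟨isIsochronousCenter_of_exp_add_exp hopen hconn h0 hf hg hK hgK,
      fun hsum hodd => ⟨fun _ => eq_zero_of_odd_of_exp_add_exp hopen hconn h0 hf.continuousOn hK
        hsymm hgK hodd hsum,
        fun _ => isIsochronousCenter_of_exp_add_exp hopen hconn h0 hf hg hK hgK hsum⟩,
      fun hodd => ⟨fun hiso => ?_, fun hloc => ?_⟩⟩⟩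
  · obtain ⟨δ, hδ, hsum⟩ := eventually_exp_add_exp_of_isIsochronousCenter hopen hconn h0
      hf.continuousOn hK hgK hiso
    obtain ⟨η, hη, hN⟩ := exists_Ioo_subset_of_eventually (hopen.eventually_mem h0)
    set ε := min δ η with hε
    have hεpos : 0 < ε := lt_min hδ hη
    have hsub : Set.Ioo (-ε) ε ⊆ N₀ := fun x hx =>
      hN x ⟨by linarith [hx.1, min_le_right δ η], by linarith [hx.2, min_le_right δ η]⟩
    refine Filter.eventually_of_mem (Ioo_mem_nhds (neg_lt_zero.2 hεpos) hεpos)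
      (eq_zero_of_odd_of_exp_add_exp isOpen_Ioo Set.ordConnected_Ioo ⟨neg_lt_zero.2 hεpos, hεpos⟩
        (hf.continuousOn.mono hsub) hK (fun x hx => ⟨neg_lt_neg hx.2, by linarith [hx.1]⟩)
        (fun x hx => hgK x (hsub hx)) (fun x hx => hodd x (hsub hx)) fun x hx => ?_)
    -- The Abel argument gives the equation only for `x > 0`; it is symmetric under `x ↦ -x` and
    -- trivial at `0`.
    rcases lt_trichotomy x 0 with h | h | h
    · have := hsum (-x) ⟨by linarith, by linarith [hx.1, min_le_left δ η]⟩
      rw [neg_neg] at this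
      linarith
    · simp only [h, neg_zero, primitiveF_zero, Real.exp_zero]
      norm_num
    · exact hsum x ⟨h, by linarith [hx.2, min_le_left δ η]⟩
  · obtain ⟨δ, hδ, h⟩ := exists_Ioo_subset_of_eventually ((hopen.eventually_mem h0).and hloc)
    have hsub : Set.Ioo (-δ) δ ⊆ N₀ := fun x hx => (h x hx).1
    have h00 : (0 : ℝ) ∈ Set.Ioo (-δ) δ := ⟨neg_lt_zero.2 hδ, hδ⟩
    -- With `F = 0` on a smaller symmetric interval the functional equation is trivial there, and
    -- isochronicity is a local property.
    have hF : ∀ x ∈ Set.Ioo (-δ) δ, primitiveF f x = 0 := fun x hx => by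
      refine intervalIntegral.integral_zero_ae (Filter.Eventually.of_forall fun t ht => ?_)
      exact (h t (Set.ordConnected_Ioo.uIcc_subset h00 hx (Set.uIoc_subset_uIcc ht))).2.1
    refine isIsochronousCenter_of_exp_add_exp isOpen_Ioo Set.ordConnected_Ioo h00 (hf.mono hsub)
      (hg.mono hsub) hK (fun x hx => hgK x (hsub hx)) fun x hx => ?_
    rw [hF x hx, hF (-x) ⟨neg_lt_neg hx.2, by linarith [hx.1]⟩, Real.exp_zero]
    norm_num
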